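/- Let $X$ be an order complete vector lattice, $X^u$ its universal completion and $X_s$ its sup-completion. Here $X_s$ is the order complete cone, unique up to isomorphism over $X$, such that: $X$ is the set of invertible elements of $X_s$, with its algebraic and order structure; $y=\sup\{x\in X: x\le y\}$ for all $y\in X_s$; $x+(f\wedge y)=(x+f)\wedge(x+y)$ for $x,y\in X_s$, $f\in X$; every $y\in X_s$ that lies below an element of $X$ is in $X$; $X_s$ has a biggest element; and $\sup A\wedge x=\sup_{a\in A}(a\wedge x)$ for all non-empty $A\subset X_s$ and $x\in X$. An element $x\in X_s$ is said to belong to $X^u$ if some $f\in X^u$ satisfies $\{y\in X:y\le x\}=\{y\in X:y\le f\}$. For $0\le a\in X_s$ let $P_a$ be the band projection on $X$ given by $P_a u=\sup_{n\in\mathbb N}(u\wedge na)$ for $0\le u\in X$. Let $0<e\in X$ and $x\in X_s$. If $$\inf_{\lambda\in(0,\infty)}P_{(x-\lambda e)^+}e>0,\qquad(*)$$ then $x\notin X^u$. If, moreover, $e$ is a weak order unit of $X$ (that is, $|y|\wedge e=0$ implies $y=0$ for $y\in X$), then $x\in X_s\setminus X^u$ if and only if $(*)$ holds. -/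

import Mathlib

open scoped NNReal

set_option linter.unusedSectionVars false

/-! ### Weak order units, universal completions, sup-completions

An order complete (Dedekind complete) vector lattice is a type `X` with
`[ConditionallyCompleteLattice X] [AddCommGroup X] [IsOrderedAddMonoid X] [Module ℝ X]
[PosSMulMono ℝ X]`. -/

/-- `e > 0` is a weak order unit: only `0` is disjoint from `e`. -/
def IsWeakOrderUnit {X : Type*} [Lattice X] [AddCommGroup X] (e : X) : Prop :=
  0 < e ∧ ∀ y : X, |y| ⊓ e = 0 → y = 0

/-- Lateral completeness: every set of pairwise disjoint positive vectors has a supremum. -/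
def IsLaterallyComplete (Y : Type*) [Lattice Y] [AddCommGroup Y] : Prop :=
  ∀ S : Set Y, S.Nonempty → (∀ a ∈ S, 0 ≤ a) → S.Pairwise (fun a b => a ⊓ b = 0) →
    ∃ m, IsLUB S m

/-- `j : X → Y` exhibits `Y` as the universal completion of the vector lattice `X`: `Y` is
universally complete, i.e. order complete (the instance `ConditionallyCompleteLattice Y`) and
laterally complete, and `j` is an isomorphism of `X` onto an order dense vector sublattice
of `Y`. -/
structure IsUniversalCompletion {X Y : Type*}
    [Lattice X] [AddCommGroup X] [Module ℝ X]
    [ConditionallyCompleteLattice Y] [AddCommGroup Y] [IsOrderedAddMonoid Y]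
    [Module ℝ Y] [PosSMulMono ℝ Y] (j : X →ₗ[ℝ] Y) : Prop where
  laterally_complete : IsLaterallyComplete Y
  injective : Function.Injective j
  map_sup : ∀ x y, j (x ⊔ y) = j x ⊔ j y
  map_inf : ∀ x y, j (x ⊓ y) = j x ⊓ j y
  order_dense : ∀ f : Y, 0 < f → ∃ x : X, 0 < j x ∧ j x ≤ f

/-- `ι : X → C` exhibits the cone `C` as the sup-completion of the order complete vector
lattice `X`. That `C` is an order complete cone is expressed by the instances: a commutative
monoid with a multiplication by nonnegative reals and a compatible lattice order in which
nonempty bounded sets have suprema and infima. (These properties determine `C` up to a unique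
isomorphism over `X`. If `X` has a weak order unit `e` and `0 ≤ x`, then
`x = sup (k e ⊓ x)` follows from `isLUB_minorants` and `isLUB_inf`.) -/
structure IsSupCompletion {X C : Type*}
    [ConditionallyCompleteLattice X] [AddCommGroup X] [Module ℝ X]
    [ConditionallyCompleteLattice C] [AddCommMonoid C] [IsOrderedAddMonoid C]
    [Module ℝ≥0 C] [PosSMulMono ℝ≥0 C] (ι : X → C) : Prop where
  /-- `X` is embedded in `C` with its algebraic structure, -/
  map_add : ∀ x y, ι (x + y) = ι x + ι y
  map_smul : ∀ (r : ℝ≥0) (x : X), ι (r • x) = r • ι x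
  /-- with its order, -/
  le_iff_le : ∀ x y, ι x ≤ ι y ↔ x ≤ y
  /-- and as the set of invertible elements of `C`. -/
  isAddUnit_iff : ∀ c : C, IsAddUnit c ↔ c ∈ Set.range ι
  /-- Every `y : C` is the supremum of its minorants in `X`. -/
  isLUB_minorants : ∀ y : C, IsLUB (ι '' {x : X | ι x ≤ y}) y
  add_inf : ∀ (x y : C) (f : X), x + ι f ⊓ y = (x + ι f) ⊓ (x + y)
  /-- What lies below an element of `X` is in `X`. -/
  mem_range_of_le : ∀ (x : X) (y : C), y ≤ ι x → y ∈ Set.range ι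
  /-- `C` has a biggest element. -/
  exists_isTop : ∃ m : C, IsTop m
  /-- If `m = sup A` then `m ⊓ x = sup {a ⊓ x | a ∈ A}` for `x` in `X`. (Hence
  `sup A = sup B` implies `sup {a ⊓ x | a ∈ A} = sup {b ⊓ x | b ∈ B}`.) -/
  isLUB_inf : ∀ (A : Set C) (m : C), A.Nonempty → IsLUB A m →
    ∀ x : X, IsLUB ((fun a => a ⊓ ι x) '' A) (m ⊓ ι x)

/-- The element `x` of the sup-completion belongs to the universal completion, i.e. it is the
same as some `f` in the universal completion: both have the same minorants in `X`. (An element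
of the sup-completion is the supremum of its minorants in `X`, there is always one, and
so is an element of the universal completion that has a minorant in `X`.) -/
def MemUniversalCompletion {X C Y : Type*} [LE C] [LE Y] (ι : X → C) (j : X → Y) (x : C) :
    Prop :=
  ∃ f : Y, ∀ y : X, ι y ≤ x ↔ j y ≤ f

/-- `P_a u = sup_n (u ⊓ n a)`, for `a ≥ 0` in the sup-completion and `u ≥ 0` in `X`; the
elements `u ⊓ n a` lie in `X` because they are below `u`, and the supremum is taken in `X`. -/
noncomputable def bandProjPos {X C : Type*} [ConditionallyCompleteLattice X]
    [Lattice C] [AddCommMonoid C] (ι : X → C) (a : C) (u : X) : X :=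
  sSup {z : X | ∃ n : ℕ, ι z = ι u ⊓ n • a}

/-- The band projection `P_a` on `X` of an element `a ≥ 0` of the sup-completion:
`P_a u = P_a u⁺ - P_a u⁻`. -/
noncomputable def bandProj {X C : Type*} [ConditionallyCompleteLattice X] [AddCommGroup X]
    [Lattice C] [AddCommMonoid C] (ι : X → C) (a : C) (u : X) : X :=
  bandProjPos ι a u⁺ - bandProjPos ι a u⁻

/-- `(x - u)⁺` for `x` in the sup-completion and `u` in `X`. -/
def posPartSub {X C : Type*} [AddCommGroup X] [Lattice C] [AddCommMonoid C]
    (ι : X → C) (x : C) (u : X) : C :=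
  (x + ι (-u)) ⊔ 0

/-! ### Existence of the sup-completion

The sup-completion is built as the set of all nonempty lower sets of `X` that are closed under
existing suprema, ordered by inclusion; `x : X` corresponds to `Set.Iic x`. -/

/-- Nonempty lower sets closed under those suprema that exist. -/
def IsSupClosedLower {X : Type*} [Preorder X] (A : Set X) : Prop :=
  A.Nonempty ∧ IsLowerSet A ∧ ∀ B ⊆ A, B.Nonempty → ∀ m, IsLUB B m → m ∈ A

/-- The concrete sup-completion. -/
def SupCompletion (X : Type*) [Preorder X] : Type _ := {A : Set X // IsSupClosedLower A}

namespace SupCompletion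

section Order

variable {X : Type*} [Preorder X]

instance instPartialOrder : PartialOrder (SupCompletion X) :=
  inferInstanceAs (PartialOrder {A : Set X // IsSupClosedLower A})

/-- The smallest element of the completion containing a nonempty set. -/
def cl (S : Set X) (hS : S.Nonempty) : SupCompletion X :=
  ⟨{y | ∀ D : SupCompletion X, S ⊆ D.1 → y ∈ D.1},
    let ⟨s, hs⟩ := hS
    ⟨s, fun _ h => h hs⟩,
    fun _ _ hba ha D h => D.2.2.1 hba (ha D h),
    fun _ hB hne m hm D h => D.2.2.2 _ (fun _ hb => hB hb D h) hne m hm⟩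

theorem subset_cl {S : Set X} (hS : S.Nonempty) : S ⊆ (cl S hS).1 :=
  fun _ hs _ h => h hs

theorem cl_le {S : Set X} (hS : S.Nonempty) {D : SupCompletion X} :
    cl S hS ≤ D ↔ S ⊆ D.1 :=
  ⟨fun h => (subset_cl hS).trans h, fun h _ hy => hy D h⟩

/-- The embedding of `X`. -/
def of (x : X) : SupCompletion X :=
  ⟨Set.Iic x, ⟨x, le_rfl⟩, isLowerSet_Iic x, fun _ hB _ _ hm => hm.2 hB⟩

theorem of_le {x : X} {A : SupCompletion X} : of x ≤ A ↔ x ∈ A.1 :=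
  ⟨fun h => h (Set.mem_Iic.2 le_rfl), fun h _ hy => A.2.2.1 hy h⟩

theorem isLUB_of (A : SupCompletion X) : IsLUB (of '' {x : X | of x ≤ A}) A := by
  refine ⟨?_, fun B hB x hx => of_le.1 (hB ⟨x, of_le.2 hx, rfl⟩)⟩
  rintro _ ⟨x, hx, rfl⟩
  exact hx

end Order

variable {X : Type*} [ConditionallyCompleteLattice X] [AddCommGroup X] [IsOrderedAddMonoid X]

theorem sup_mem (A : SupCompletion X) {a b : X} (ha : a ∈ A.1) (hb : b ∈ A.1) :
    a ⊔ b ∈ A.1 :=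
  A.2.2.2 {a, b} (by rintro _ (rfl | rfl) <;> assumption) ⟨a, by simp⟩ _ isLUB_pair

open Classical in
noncomputable instance instSupSet : SupSet (SupCompletion X) :=
  ⟨fun S => if h : (⋃ A ∈ S, A.1).Nonempty then cl _ h else of 0⟩

theorem isLUB_sSup' (S : Set (SupCompletion X)) (hS : S.Nonempty) : IsLUB S (sSup S) := by
  have h : (⋃ A ∈ S, A.1).Nonempty := by
    obtain ⟨A, hA⟩ := hS
    obtain ⟨a, ha⟩ := A.2.1
    exact ⟨a, Set.mem_biUnion hA ha⟩
  have : sSup S = cl _ h := dif_pos h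
  rw [this]
  refine ⟨fun A hA => (Set.subset_biUnion_of_mem hA).trans (subset_cl h), fun B hB => ?_⟩
  rw [cl_le]
  exact Set.iUnion₂_subset fun A hA => hB hA

noncomputable instance instLattice : ConditionallyCompleteLattice (SupCompletion X) :=
  conditionallyCompleteLatticeOfsSup _
    (fun _ _ => ⟨cl Set.univ ⟨0, trivial⟩, fun _ _ _ _ => subset_cl _ (Set.mem_univ _)⟩)
    (fun A B => by
      obtain ⟨a, ha⟩ := A.2.1
      obtain ⟨b, hb⟩ := B.2.1
      refine ⟨of (a ⊓ b), ?_⟩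
      intro D hD
      rcases hD with h | h <;> rw [h]
      · exact of_le.2 (A.2.2.1 inf_le_left ha)
      · exact of_le.2 (B.2.2.1 inf_le_right hb))
    (fun S _ hS => isLUB_sSup' S hS)

theorem mem_inf {A B : SupCompletion X} {x : X} : x ∈ (A ⊓ B).1 ↔ x ∈ A.1 ∧ x ∈ B.1 := by
  rw [← of_le, ← of_le, ← of_le, le_inf_iff]

theorem isLUB_const_inf {B : Set X} {m : X} (h : IsLUB B m) (c : X) :
    IsLUB ((fun b => c ⊓ b) '' B) (c ⊓ m) := by
  refine ⟨?_, fun w hw => ?_⟩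
  · rintro _ ⟨b, hb, rfl⟩
    exact inf_le_inf_left c (h.1 hb)
  · have key : m ≤ w + (c ⊔ m) - c := h.2 fun b hb => by
      rw [le_sub_iff_add_le, add_comm b c, ← inf_add_sup c b]
      exact add_le_add (hw ⟨b, hb, rfl⟩) (sup_le_sup_left (h.1 hb) c)
    rw [le_sub_iff_add_le, add_comm m c, ← inf_add_sup c m] at key
    exact le_of_add_le_add_right key

/-- `{z | c ⊓ z ∈ D}`. -/
def infRes (c : X) (D : SupCompletion X) : SupCompletion X :=
  ⟨{z | c ⊓ z ∈ D.1},
    let ⟨d, hd⟩ := D.2.1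
    ⟨d, D.2.2.1 inf_le_right hd⟩,
    fun _ _ hba ha => D.2.2.1 (inf_le_inf_left c hba) ha,
    fun B hB hne m hm => D.2.2.2 ((fun b => c ⊓ b) '' B)
      (by rintro _ ⟨b, hb, rfl⟩; exact hB hb) (hne.image _) _ (isLUB_const_inf hm c)⟩

/-- `{z | z + c ∈ D}`. -/
def shift (c : X) (D : SupCompletion X) : SupCompletion X :=
  ⟨{z | z + c ∈ D.1},
    let ⟨d, hd⟩ := D.2.1
    ⟨d - c, by simpa using hd⟩,
    fun _ _ hba ha => D.2.2.1 (by gcongr) ha,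
    fun B hB hne m hm => D.2.2.2 ((fun b => b + c) '' B)
      (by rintro _ ⟨b, hb, rfl⟩; exact hB hb) (hne.image _) _
      ⟨by rintro _ ⟨b, hb, rfl⟩; exact add_le_add_left (hm.1 hb) c,
       fun w hw => by
        rw [← le_sub_iff_add_le]
        exact hm.2 fun b hb => le_sub_iff_add_le.2 (hw ⟨b, hb, rfl⟩)⟩⟩

open scoped Pointwise in
instance instAdd : Add (SupCompletion X) :=
  ⟨fun A B => cl (A.1 + B.1) (A.2.1.add B.2.1)⟩

theorem add_le {A B D : SupCompletion X} :
    A + B ≤ D ↔ ∀ a ∈ A.1, ∀ b ∈ B.1, a + b ∈ D.1 := by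
  refine (cl_le _).trans ?_
  rw [Set.add_subset_iff]

theorem add_mem {A B : SupCompletion X} {a b : X} (ha : a ∈ A.1) (hb : b ∈ B.1) :
    a + b ∈ (A + B).1 :=
  add_le.1 le_rfl a ha b hb

theorem add_add_le {A B E D : SupCompletion X} :
    A + B + E ≤ D ↔ ∀ a ∈ A.1, ∀ b ∈ B.1, ∀ c ∈ E.1, a + b + c ∈ D.1 := by
  refine ⟨fun h a ha b hb c hc => h (add_mem (add_mem ha hb) hc), fun h => ?_⟩
  refine add_le.2 fun y hy c hc => ?_
  exact hy (shift c D) (by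
    rintro _ ⟨a, ha, b, hb, rfl⟩
    exact h a ha b hb c hc)

instance instZero : Zero (SupCompletion X) := ⟨of 0⟩

theorem add_comm' (A B : SupCompletion X) : A + B = B + A :=
  eq_of_forall_ge_iff fun D => by
    rw [add_le, add_le]
    exact ⟨fun h a ha b hb => add_comm b a ▸ h b hb a ha,
      fun h a ha b hb => add_comm b a ▸ h b hb a ha⟩

theorem zero_add' (A : SupCompletion X) : 0 + A = A := by
  refine le_antisymm (add_le.2 fun a ha b hb => ?_) fun a ha => ?_
  · exact A.2.2.1 (add_le_of_nonpos_left ha) hb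
  · simpa using add_mem (A := 0) (a := 0) (Set.mem_Iic.2 le_rfl) ha

noncomputable instance instAddCommMonoid : AddCommMonoid (SupCompletion X) where
  add_assoc A B E := eq_of_forall_ge_iff fun D => by
    rw [add_add_le, add_comm' A, add_add_le]
    constructor
    · intro h b hb c hc a ha
      have := h a ha b hb c hc
      rwa [add_assoc, add_comm] at this
    · intro h a ha b hb c hc
      have := h b hb c hc a ha
      rwa [add_comm, ← add_assoc] at this
  zero_add := zero_add'
  add_zero A := by rw [add_comm', zero_add']
  add_comm := add_comm'
  nsmul := nsmulRec

instance instIsOrderedAddMonoid : IsOrderedAddMonoid (SupCompletion X) where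
  add_le_add_left _ _ h _ := add_le.2 fun _ ha _ hb => add_mem (h ha) hb

theorem of_add (x y : X) : of (x + y) = of x + of y := by
  refine le_antisymm (of_le.2 (add_mem (Set.mem_Iic.2 le_rfl) (Set.mem_Iic.2 le_rfl)))
    (add_le.2 fun a ha b hb => add_le_add ha hb)

theorem of_injective : Function.Injective (of : X → SupCompletion X) := fun _ _ h =>
  le_antisymm (of_le.1 h.le) (of_le.1 h.ge)

theorem mem_range_of_bdd {A : SupCompletion X} (h : BddAbove A.1) : A ∈ Set.range of := by
  have hl := isLUB_csSup A.2.1 h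
  exact ⟨sSup A.1, le_antisymm (of_le.2 (A.2.2.2 _ le_rfl A.2.1 _ hl)) hl.1⟩

theorem isAddUnit_iff' (A : SupCompletion X) : IsAddUnit A ↔ A ∈ Set.range of := by
  rw [isAddUnit_iff_exists_neg]
  constructor
  · rintro ⟨B, hB⟩
    obtain ⟨b, hb⟩ := B.2.1
    exact mem_range_of_bdd ⟨-b, fun a ha =>
      le_neg_iff_add_nonpos_right.2 (add_le.1 hB.le a ha b hb)⟩
  · rintro ⟨x, rfl⟩
    exact ⟨of (-x), by rw [← of_add, add_neg_cancel]; rfl⟩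

theorem add_inf' (A B : SupCompletion X) (f : X) :
    A + of f ⊓ B = (A + of f) ⊓ (A + B) := by
  refine le_antisymm (le_inf (by gcongr; exact inf_le_left) (by gcongr; exact inf_le_right)) ?_
  intro c hc
  rw [mem_inf] at hc
  have h1 : c - f ∈ A.1 := by
    have h : A + of f ≤ shift (-f) A := add_le.2 fun a ha b hb =>
      A.2.2.1 (show a + b + -f ≤ a by
        rw [add_assoc]
        exact add_le_of_nonpos_right (by simpa [← sub_eq_add_neg] using (show b ≤ f from hb))) ha
    simpa [sub_eq_add_neg] using (show c + -f ∈ A.1 from h hc.1)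
  have h2 : A + B ≤ infRes c (A + of f ⊓ B) := add_le.2 fun a ha b hb => by
    have h3 : c ⊓ (a + b) ≤ ((c - f) ⊔ a) + f ⊓ b := by
      rw [add_inf]
      refine le_inf (inf_le_left.trans ?_) (inf_le_right.trans ?_)
      · exact sub_le_iff_le_add.1 le_sup_left
      · gcongr
        exact le_sup_right
    refine (A + of f ⊓ B).2.2.1 h3 (add_mem (sup_mem A h1 ha) (mem_inf.2 ⟨?_, ?_⟩))
    · exact Set.mem_Iic.2 inf_le_left
    · exact B.2.2.1 inf_le_right hb
  have h4 : c ⊓ c ∈ (A + of f ⊓ B).1 := h2 hc.2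
  simpa using h4

theorem isLUB_inf' (S : Set (SupCompletion X)) (M : SupCompletion X) (_ : S.Nonempty)
    (hM : IsLUB S M) (x : X) : IsLUB ((fun A => A ⊓ of x) '' S) (M ⊓ of x) := by
  refine ⟨?_, fun D hD y hy => ?_⟩
  · rintro _ ⟨A, hA, rfl⟩
    exact inf_le_inf_right _ (hM.1 hA)
  · rw [mem_inf] at hy
    have h : M ≤ infRes y D := hM.2 fun A hA a ha =>
      hD ⟨A, hA, rfl⟩ (mem_inf.2 ⟨A.2.2.1 inf_le_right ha, inf_le_left.trans hy.2⟩)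
    have h4 : y ⊓ y ∈ D.1 := h hy.1
    simpa using h4

variable [Module ℝ X] [PosSMulMono ℝ X]

theorem nnsmul_mono (r : ℝ≥0) {a b : X} (h : a ≤ b) : r • a ≤ r • b :=
  smul_le_smul_of_nonneg_left (α := ℝ) h r.2

/-- `r • A` for `r > 0`, and `0 • A = 0`. -/
instance instSMul : SMul ℝ≥0 (SupCompletion X) :=
  ⟨fun r A => cl ((fun a => r • a) '' A.1) (A.2.1.image _)⟩

theorem smul_le {r : ℝ≥0} {A D : SupCompletion X} : r • A ≤ D ↔ ∀ a ∈ A.1, r • a ∈ D.1 :=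
  (cl_le _).trans Set.image_subset_iff

theorem smul_mem {r : ℝ≥0} {A : SupCompletion X} {a : X} (ha : a ∈ A.1) :
    r • a ∈ (r • A).1 :=
  smul_le.1 le_rfl a ha

/-- `{z | r • z ∈ D}` for `r ≠ 0`. -/
def scale (r : ℝ≥0) (hr : r ≠ 0) (D : SupCompletion X) : SupCompletion X :=
  ⟨{z | r • z ∈ D.1},
    let ⟨d, hd⟩ := D.2.1
    ⟨r⁻¹ • d, by simpa [smul_smul, hr] using hd⟩,
    fun _ _ hba ha => D.2.2.1 (nnsmul_mono r hba) ha,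
    fun B hB hne m hm => D.2.2.2 ((fun b => r • b) '' B)
      (by rintro _ ⟨b, hb, rfl⟩; exact hB hb) (hne.image _) _
      ⟨by rintro _ ⟨b, hb, rfl⟩; exact nnsmul_mono r (hm.1 hb),
       fun w hw => by
        have : m ≤ r⁻¹ • w := hm.2 fun b hb => by
          have := nnsmul_mono r⁻¹ (hw ⟨b, hb, rfl⟩)
          simpa [smul_smul, hr] using this
        have := nnsmul_mono r this
        simpa [smul_smul, hr] using this⟩⟩

theorem smul_of (r : ℝ≥0) (x : X) : of (r • x) = r • of x :=
  le_antisymm (of_le.2 (smul_mem (Set.mem_Iic.2 le_rfl)))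
    (smul_le.2 fun _ ha => nnsmul_mono r ha)

theorem zero_smul' (A : SupCompletion X) : (0 : ℝ≥0) • A = 0 := by
  refine le_antisymm (smul_le.2 fun a _ => ?_) (of_le.2 ?_)
  · rw [zero_smul]
    exact Set.mem_Iic.2 le_rfl
  · obtain ⟨a, ha⟩ := A.2.1
    simpa using smul_mem (r := 0) ha

noncomputable instance instModule : Module ℝ≥0 (SupCompletion X) where
  one_smul A := eq_of_forall_ge_iff fun D => by
    rw [smul_le]
    simp only [one_smul]
    rfl
  mul_smul r s A := by
    by_cases hr : r = 0
    · rw [hr, zero_mul, zero_smul', zero_smul']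
    refine le_antisymm (smul_le.2 fun a ha => ?_) (smul_le.2 fun b hb => ?_)
    · rw [mul_smul]
      exact smul_mem (smul_mem ha)
    · have : s • A ≤ scale r hr ((r * s) • A) := smul_le.2 fun a ha => by
        change r • s • a ∈ ((r * s) • A).1
        rw [← mul_smul]
        exact smul_mem ha
      exact this hb
  smul_zero r := by
    change r • of 0 = of 0
    rw [← smul_of, smul_zero]
  smul_add r A B := by
    by_cases hr : r = 0
    · rw [hr, zero_smul', zero_smul', zero_smul', zero_add]
    refine le_antisymm (smul_le.2 fun c hc => ?_) ?_
    · have : A + B ≤ scale r hr (r • A + r • B) := add_le.2 fun a ha b hb => by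
        change r • (a + b) ∈ (r • A + r • B).1
        rw [smul_add]
        exact add_mem (smul_mem ha) (smul_mem hb)
      exact this hc
    · refine add_le.2 fun a ha b hb => ?_
      have hA : r • A ≤ shift b (r • (A + B)) := smul_le.2 fun a ha => by
        change r • a + b ∈ (r • (A + B)).1
        have hB : r • B ≤ shift (r • a) (r • (A + B)) := smul_le.2 fun b hb => by
          change r • b + r • a ∈ (r • (A + B)).1
          rw [add_comm (r • b), ← smul_add]
          exact smul_mem (add_mem ha hb)
        rw [add_comm (r • a)]
        exact hB hb
      exact hA ha
  add_smul r s A := by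
    refine le_antisymm (smul_le.2 fun a ha => ?_) (add_le.2 fun a ha b hb => ?_)
    · rw [add_smul]
      exact add_mem (smul_mem ha) (smul_mem ha)
    · have hA : r • A ≤ shift b ((r + s) • A) := smul_le.2 fun a ha => by
        change r • a + b ∈ ((r + s) • A).1
        have hB : s • A ≤ shift (r • a) ((r + s) • A) := smul_le.2 fun b hb => by
          refine ((r + s) • A).2.2.1 ?_ (smul_mem (sup_mem A ha hb))
          rw [add_smul, add_comm (s • b)]
          exact add_le_add (nnsmul_mono r le_sup_left) (nnsmul_mono s le_sup_right)
        rw [add_comm (r • a)]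
        exact hB hb
      exact hA ha
  zero_smul := zero_smul'

instance instPosSMulMono : PosSMulMono ℝ≥0 (SupCompletion X) where
  smul_le_smul_of_nonneg_left _ _ _ _ h := smul_le.2 fun _ ha => smul_mem (h ha)

/-- Every order complete vector lattice has a sup-completion. -/
theorem isSupCompletion_of : IsSupCompletion (of : X → SupCompletion X) where
  map_add := of_add
  map_smul := smul_of
  le_iff_le _ _ := of_le
  isAddUnit_iff := isAddUnit_iff'
  isLUB_minorants := isLUB_of
  add_inf := add_inf'
  mem_range_of_le x _ h := mem_range_of_bdd ⟨x, fun _ ha => h ha⟩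
  exists_isTop := ⟨cl Set.univ ⟨0, trivial⟩, fun _ _ _ => subset_cl _ trivial⟩
  isLUB_inf := isLUB_inf'

end SupCompletion

/-! Write `p_t = P_{(x - te)⁺} e`, which decreases in `t`. By `isLUB_bandProj` it is the supremum of
`e ⊓ n(y - te)⁺` over `n` and the minorants `y ∈ X` of `x`, so the argument takes place in `X` and
`X^u`. If `x` is represented by `f ∈ X^u`, a Markov-type inequality gives `N p_N ≤ f⁺`; a common
lower bound `p > 0` of all `p_t` would satisfy `N p ≤ f⁺` for every `N`, against the Archimedean
property. Conversely, let `e` be a weak unit and let no `z > 0` lie below all `p_t`. The `p_n` are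
components of `e`, so the layers `r_n = p_n - p_{n+1}` (with `p_0 = e`) are pairwise disjoint and
exhaust `e`. On `r_n` the element `x` is at most `(n+1)e`. Lateral completeness provides `g = sup
(n+1) r_n` in `X^u`, and `g` dominates all minorants of `x`; their supremum in `X^u` then represents
`x`. -/

namespace LatticeGroup

/-! ### Disjointness and a Markov inequality in lattice-ordered groups. -/

variable {G : Type*} [Lattice G] [AddCommGroup G] [IsOrderedAddMonoid G]

theorem inf_add_le {a b c : G} (ha : 0 ≤ a) (hb : 0 ≤ b) (hc : 0 ≤ c) :
    c ⊓ (a + b) ≤ c ⊓ a + c ⊓ b := by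
  rw [inf_add, add_inf, add_inf]
  refine le_inf (le_inf ?_ ?_) (le_inf ?_ inf_le_right)
  · exact inf_le_left.trans (le_add_of_nonneg_left hc)
  · exact inf_le_left.trans (le_add_of_nonneg_right hb)
  · exact inf_le_left.trans (le_add_of_nonneg_left ha)

theorem inf_add_eq_zero {a b c : G} (ha : 0 ≤ a) (hb : 0 ≤ b) (hc : 0 ≤ c)
    (hca : c ⊓ a = 0) (hcb : c ⊓ b = 0) : c ⊓ (a + b) = 0 :=
  le_antisymm ((inf_add_le ha hb hc).trans (by simp [hca, hcb]))
    (le_inf hc (add_nonneg ha hb))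

theorem inf_nsmul_eq_zero {a c : G} (ha : 0 ≤ a) (hc : 0 ≤ c) (hca : c ⊓ a = 0) (n : ℕ) :
    c ⊓ n • a = 0 := by
  induction n with
  | zero => simpa using hc
  | succ n ih =>
    rw [succ_nsmul]
    exact inf_add_eq_zero (nsmul_nonneg ha n) ha hc ih hca

theorem inf_eq_zero_of_le {a b a' b' : G} (ha : 0 ≤ a) (hb : 0 ≤ b) (haa : a ≤ a')
    (hbb : b ≤ b') (h : a' ⊓ b' = 0) : a ⊓ b = 0 :=
  le_antisymm (h ▸ inf_le_inf haa hbb) (le_inf ha hb)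

theorem inf_sum_eq_zero {c : G} (hc : 0 ≤ c) {r : ℕ → G} (hr : ∀ n, 0 ≤ r n)
    (h : ∀ n, c ⊓ r n = 0) (N : ℕ) : c ⊓ ∑ n ∈ Finset.range N, r n = 0 := by
  induction N with
  | zero => simpa using hc
  | succ N ih =>
    rw [Finset.sum_range_succ]
    exact inf_add_eq_zero (Finset.sum_nonneg fun i _ => hr i) (hr N) hc ih (h N)

theorem posPart_le_of_le {a b : G} (h : a ≤ b) (hb : 0 ≤ b) : a⁺ ≤ b := sup_le h hb

theorem le_of_posPart_sub_nonpos {a b : G} (h : (a - b)⁺ ≤ 0) : a ≤ b :=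
  sub_nonpos.1 ((le_posPart _).trans h)

/-- Markov's inequality: `e ⊓ n(y - Ne)⁺` lives where `y ≥ Ne`. The left side minus `y⁺` is bounded
both by `(y - Ne)⁻` and by a multiple of `(y - Ne)⁺`, which are disjoint. -/
theorem nsmul_inf_nsmul_posPart_sub_le (e y : G) (N n : ℕ) :
    N • (e ⊓ n • (y - N • e)⁺) ≤ y⁺ := by
  have hu : 0 ≤ (y - N • e)⁺ := posPart_nonneg _
  have hv : 0 ≤ (y - N • e)⁻ := negPart_nonneg _
  refine le_of_posPart_sub_nonpos ?_
  -- The right-hand `0` becomes `(y - Ne)⁻ ⊓ (N * n)(y - Ne)⁺`, so two separate bounds suffice.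
  rw [← inf_nsmul_eq_zero hu hv (inf_comm _ _ |>.trans (posPart_inf_negPart_eq_zero _)) (N * n)]
  refine le_inf (posPart_le_of_le ?_ hv) (posPart_le_of_le ?_ (nsmul_nonneg hu _))
  · calc N • (e ⊓ n • (y - N • e)⁺) - y⁺ ≤ N • e - y :=
          sub_le_sub (nsmul_le_nsmul_right inf_le_left N) (le_posPart y)
      _ = -(y - N • e) := by abel
      _ ≤ _ := neg_le_negPart _
  · calc N • (e ⊓ n • (y - N • e)⁺) - y⁺ ≤ N • (e ⊓ n • (y - N • e)⁺) :=
          sub_le_self _ (posPart_nonneg y)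
      _ ≤ N • n • (y - N • e)⁺ := nsmul_le_nsmul_right inf_le_right N
      _ = _ := by rw [mul_comm, mul_nsmul]

end LatticeGroup

/-- Archimedean property from order completeness: the supremum of the multiples of `u` absorbs one
more `u`. -/
theorem nonpos_of_forall_nsmul_le {Y : Type*} [ConditionallyCompleteLattice Y] [AddCommGroup Y]
    [IsOrderedAddMonoid Y] {u g : Y} (h : ∀ n : ℕ, (n + 1) • u ≤ g) : u ≤ 0 := by
  have hb : BddAbove (Set.range fun n : ℕ => (n + 1) • u) :=
    ⟨g, by rintro _ ⟨n, rfl⟩; exact h n⟩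
  have key : (⨆ n : ℕ, (n + 1) • u) ≤ (⨆ n : ℕ, (n + 1) • u) - u := ciSup_le fun n => by
    rw [le_sub_iff_add_le, ← succ_nsmul]
    exact le_ciSup hb (n + 1)
  simpa using key

/-! ### The embedding into the universal completion. -/

namespace IsUniversalCompletion

variable {X Y : Type*}
  [Lattice X] [AddCommGroup X] [IsOrderedAddMonoid X] [Module ℝ X]
  [ConditionallyCompleteLattice Y] [AddCommGroup Y] [IsOrderedAddMonoid Y]
  [Module ℝ Y] [PosSMulMono ℝ Y] {j : X →ₗ[ℝ] Y}

theorem le_iff_le (hj : IsUniversalCompletion j) {a b : X} : j a ≤ j b ↔ a ≤ b := by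
  rw [← inf_eq_left, ← inf_eq_left, ← hj.map_inf, hj.injective.eq_iff]

theorem pos_iff (hj : IsUniversalCompletion j) {a : X} : 0 < j a ↔ 0 < a := by
  simp only [lt_iff_le_not_ge, ← hj.le_iff_le, map_zero]

theorem map_posPart (hj : IsUniversalCompletion j) (a : X) : j a⁺ = (j a)⁺ := by
  simp [posPart_def, hj.map_sup]

/-- The embedding into the universal completion preserves suprema. -/
theorem isLUB_image (hj : IsUniversalCompletion j) {S : Set X} {m : X} (hm : IsLUB S m) :
    IsLUB (j '' S) (j m) := by
  refine ⟨?_, fun g hg => ?_⟩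
  · rintro _ ⟨s, hs, rfl⟩
    exact hj.le_iff_le.2 (hm.1 hs)
  · by_contra hlt
    have hpos : 0 < (j m - g)⁺ := (posPart_nonneg _).lt_of_ne' fun h0 =>
      hlt (LatticeGroup.le_of_posPart_sub_nonpos h0.le)
    -- A nonzero gap between `j m` and `g` contains some `j z > 0`; then `m - z` is a smaller upper
    -- bound of `S`.
    obtain ⟨z, hz, hzle⟩ := hj.order_dense _ hpos
    have : m ≤ m - z := hm.2 fun s hs => by
      rw [le_sub_comm, ← hj.le_iff_le, map_sub]
      exact hzle.trans (LatticeGroup.posPart_le_of_le (sub_le_sub_left (hg ⟨s, hs, rfl⟩) _)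
        (sub_nonneg.2 (hj.le_iff_le.2 (hm.1 hs))))
    exact (hj.pos_iff.1 hz).not_ge (by simpa using this)

end IsUniversalCompletion

/-! ### Suprema and band projections through the sup-completion. -/

namespace IsSupCompletion

variable {X C : Type*}
  [ConditionallyCompleteLattice X] [AddCommGroup X] [IsOrderedAddMonoid X]
  [Module ℝ X] [PosSMulMono ℝ X]
  [ConditionallyCompleteLattice C] [AddCommMonoid C] [IsOrderedAddMonoid C]
  [Module ℝ≥0 C] [PosSMulMono ℝ≥0 C] {ι : X → C}

theorem map_zero (hι : IsSupCompletion ι) : ι 0 = 0 := by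
  have h := hι.map_smul 0 0
  rwa [zero_smul, zero_smul] at h

theorem map_nsmul (hι : IsSupCompletion ι) (n : ℕ) (a : X) : ι (n • a) = n • ι a := by
  induction n with
  | zero => simp [hι.map_zero]
  | succ n ih => rw [succ_nsmul, succ_nsmul, hι.map_add, ih]

theorem map_inf (hι : IsSupCompletion ι) (a b : X) : ι (a ⊓ b) = ι a ⊓ ι b := by
  refine le_antisymm
    (le_inf ((hι.le_iff_le _ _).2 inf_le_left) ((hι.le_iff_le _ _).2 inf_le_right)) ?_
  obtain ⟨c, hc⟩ := hι.mem_range_of_le a (ι a ⊓ ι b) inf_le_left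
  rw [← hc, hι.le_iff_le]
  exact le_inf ((hι.le_iff_le _ _).1 (hc.trans_le inf_le_left))
    ((hι.le_iff_le _ _).1 (hc.trans_le inf_le_right))

theorem map_sup (hι : IsSupCompletion ι) (a b : X) : ι (a ⊔ b) = ι a ⊔ ι b := by
  have hle : ι a ⊔ ι b ≤ ι (a ⊔ b) :=
    sup_le ((hι.le_iff_le _ _).2 le_sup_left) ((hι.le_iff_le _ _).2 le_sup_right)
  refine le_antisymm ?_ hle
  obtain ⟨c, hc⟩ := hι.mem_range_of_le _ _ hle
  rw [← hc, hι.le_iff_le]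
  exact sup_le ((hι.le_iff_le _ _).1 (le_sup_left.trans_eq hc.symm))
    ((hι.le_iff_le _ _).1 (le_sup_right.trans_eq hc.symm))

/-- Without minorants `x` would be the supremum of the empty set, hence below `ι 0`, hence in `X`
and its own minorant. -/
theorem minorants_nonempty (hι : IsSupCompletion ι) (x : C) : {y : X | ι y ≤ x}.Nonempty := by
  by_contra h
  rw [Set.not_nonempty_iff_eq_empty] at h
  have hx := hι.isLUB_minorants x
  rw [h, Set.image_empty, isLUB_empty_iff] at hx
  obtain ⟨z, rfl⟩ := hι.mem_range_of_le 0 x (hx _)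
  exact Set.notMem_empty z (h ▸ le_rfl (a := ι z))

/-- The supremum of `ι '' S` in `C` lies below `ι m`, so it belongs to `X` and must equal `ι m`. -/
theorem le_of_isLUB (hι : IsSupCompletion ι) {x : C} {S : Set X} {m : X} (hS : S.Nonempty)
    (hm : IsLUB S m) (h : ∀ s ∈ S, ι s ≤ x) : ι m ≤ x := by
  have hs : IsLUB (ι '' S) (sSup (ι '' S)) :=
    isLUB_csSup (hS.image ι) ⟨x, by rintro _ ⟨s, hs, rfl⟩; exact h s hs⟩
  have hle : sSup (ι '' S) ≤ ι m := hs.2 (by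
    rintro _ ⟨s, hs, rfl⟩; exact (hι.le_iff_le _ _).2 (hm.1 hs))
  obtain ⟨c, hc⟩ := hι.mem_range_of_le _ _ hle
  rw [← hc] at hs
  have hmc : m ≤ c := hm.2 fun s h' => (hι.le_iff_le _ _).1 (hs.1 ⟨s, h', rfl⟩)
  exact ((hι.le_iff_le _ _).2 hmc).trans (hs.2 (by rintro _ ⟨s, h', rfl⟩; exact h s h'))

theorem map_posPart_sub (hι : IsSupCompletion ι) (y u : X) :
    ι (y - u)⁺ = (ι y + ι (-u)) ⊔ 0 := by
  rw [posPart_def, hι.map_sup, hι.map_zero, sub_eq_add_neg, hι.map_add]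

/-- Translation by `ι (-u)` and scaling by `n > 0` are invertible, so they carry the supremum `x` of
its minorants along. -/
theorem isLUB_nsmul_posPartSub (hι : IsSupCompletion ι) (x : C) (u : X) (n : ℕ) :
    IsLUB {c | ∃ y, ι y ≤ x ∧ c = n • ι (y - u)⁺} (n • posPartSub ι x u) := by
  refine ⟨?_, fun b hb => ?_⟩
  · rintro _ ⟨y, hy, rfl⟩
    rw [hι.map_posPart_sub]
    exact nsmul_le_nsmul_right (sup_le_sup_right (add_le_add_left hy _) _) n
  obtain ⟨y₀, hy₀⟩ := hι.minorants_nonempty x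
  rcases Nat.eq_zero_or_pos n with rfl | hn
  · simpa using hb ⟨y₀, hy₀, rfl⟩
  have hn' : (n : ℝ≥0) ≠ 0 := by positivity
  have key : ∀ y, ι y ≤ x → (ι y + ι (-u)) ⊔ 0 ≤ (n : ℝ≥0)⁻¹ • b := fun y hy => by
    have h := smul_le_smul_of_nonneg_left (hb ⟨y, hy, rfl⟩) (zero_le (a := (n : ℝ≥0)⁻¹))
    rwa [← Nat.cast_smul_eq_nsmul ℝ≥0, smul_smul, inv_mul_cancel₀ hn', one_smul,
      hι.map_posPart_sub] at h
  have hu : ι (-u) + ι u = 0 := by rw [← hι.map_add, neg_add_cancel, hι.map_zero]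
  have hx : x ≤ (n : ℝ≥0)⁻¹ • b + ι u := (hι.isLUB_minorants x).2 (by
    rintro _ ⟨y, hy, rfl⟩
    have h := add_le_add_left (le_sup_left.trans (key y hy)) (ι u)
    rwa [add_assoc, hu, add_zero] at h)
  have hle : posPartSub ι x u ≤ (n : ℝ≥0)⁻¹ • b := by
    refine sup_le ?_ (le_sup_right.trans (key y₀ hy₀))
    have h := add_le_add_left hx (ι (-u))
    rwa [add_assoc, add_comm (ι u), hu, add_zero] at h
  have h := nsmul_le_nsmul_right hle n
  rwa [← Nat.cast_smul_eq_nsmul ℝ≥0 n ((n : ℝ≥0)⁻¹ • b), smul_smul, mul_inv_cancel₀ hn',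
    one_smul] at h

theorem bandProj_of_nonneg (hι : IsSupCompletion ι) {a : C} (ha : 0 ≤ a) {e : X} (he : 0 ≤ e) :
    bandProj ι a e = bandProjPos ι a e := by
  have h0 : bandProjPos ι a 0 = 0 := by
    have : {z : X | ∃ n : ℕ, ι z = ι 0 ⊓ n • a} = {0} := by
      ext z
      have hn (n : ℕ) : ι 0 ⊓ n • a = ι 0 := inf_eq_left.2 (hι.map_zero ▸ nsmul_nonneg ha n)
      simp only [Set.mem_ofPred_eq, hn, exists_const, Set.mem_singleton_iff]
      exact ⟨fun h => le_antisymm ((hι.le_iff_le _ _).1 h.le) ((hι.le_iff_le _ _).1 h.ge),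
        fun h => h ▸ rfl⟩
    rw [bandProjPos, this, csSup_singleton]
  rw [bandProj, posPart_of_nonneg he, negPart_of_nonneg he, h0, sub_zero]

/-- The band projection of `(x - u)⁺` in terms of the minorants of `x` in `X`. -/
theorem isLUB_bandProj (hι : IsSupCompletion ι) (x : C) (u : X) {e : X} (he : 0 ≤ e) :
    IsLUB {z | ∃ y, ι y ≤ x ∧ ∃ n : ℕ, z = e ⊓ n • (y - u)⁺}
      (bandProj ι (posPartSub ι x u) e) := by
  rw [hι.bandProj_of_nonneg (a := posPartSub ι x u) le_sup_right he, bandProjPos]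
  set a := posPartSub ι x u
  have hlub : IsLUB {z : X | ∃ n : ℕ, ι z = ι e ⊓ n • a}
      (sSup {z : X | ∃ n : ℕ, ι z = ι e ⊓ n • a}) := by
    refine isLUB_csSup ?_ ⟨e, ?_⟩
    · obtain ⟨z, hz⟩ := hι.mem_range_of_le e (ι e ⊓ 0 • a) inf_le_left
      exact ⟨z, 0, hz⟩
    · rintro z ⟨n, hz⟩
      exact (hι.le_iff_le _ _).1 (hz.trans_le inf_le_left)
  have hn (n : ℕ) := hι.isLUB_nsmul_posPartSub x u n
  refine ⟨?_, fun b hb => hlub.2 ?_⟩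
  · rintro _ ⟨y, hy, n, rfl⟩
    obtain ⟨z, hz⟩ := hι.mem_range_of_le e (ι e ⊓ n • a) inf_le_left
    refine le_trans ((hι.le_iff_le _ _).1 ?_) (hlub.1 ⟨n, hz⟩)
    rw [hz, hι.map_inf, hι.map_nsmul]
    exact inf_le_inf_left _ ((hn n).1 ⟨y, hy, rfl⟩)
  · rintro z ⟨n, hz⟩
    obtain ⟨y₀, hy₀⟩ := hι.minorants_nonempty x
    rw [← hι.le_iff_le, hz, inf_comm]
    have hne : {c | ∃ y, ι y ≤ x ∧ c = n • ι (y - u)⁺}.Nonempty := ⟨_, y₀, hy₀, rfl⟩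
    -- The supremum over minorants passes through the meet with `e`.
    refine (hι.isLUB_inf _ _ hne (hn n) e).2 ?_
    rintro _ ⟨_, ⟨y, hy, rfl⟩, rfl⟩
    change _ ⊓ _ ≤ _
    rw [inf_comm, ← hι.map_nsmul, ← hι.map_inf, hι.le_iff_le]
    exact hb ⟨y, hy, n, rfl⟩

variable {x : C} {e : X}

theorem bandProj_nonneg (hι : IsSupCompletion ι) (x : C) (u : X) (he : 0 ≤ e) :
    0 ≤ bandProj ι (posPartSub ι x u) e := by
  obtain ⟨y, hy⟩ := hι.minorants_nonempty x
  exact (hι.isLUB_bandProj x u he).1 ⟨y, hy, 0, by simpa using he⟩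

theorem bandProj_le (hι : IsSupCompletion ι) (x : C) (u : X) (he : 0 ≤ e) :
    bandProj ι (posPartSub ι x u) e ≤ e :=
  (hι.isLUB_bandProj x u he).2 (by rintro _ ⟨y, -, n, rfl⟩; exact inf_le_left)

theorem bandProj_antitone (hι : IsSupCompletion ι) (x : C) (he : 0 ≤ e) {u v : X} (h : u ≤ v) :
    bandProj ι (posPartSub ι x v) e ≤ bandProj ι (posPartSub ι x u) e := by
  refine (hι.isLUB_bandProj x v he).2 ?_
  rintro _ ⟨y, hy, n, rfl⟩
  refine le_trans ?_ ((hι.isLUB_bandProj x u he).1 ⟨y, hy, n, rfl⟩)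
  exact inf_le_inf_left _ (nsmul_le_nsmul_right (posPart_mono (sub_le_sub_left h y)) n)

/-- `P_a e` is a component of `e`. -/
theorem bandProj_inf_sub (hι : IsSupCompletion ι) (x : C) (u : X) (he : 0 ≤ e) :
    bandProj ι (posPartSub ι x u) e ⊓ (e - bandProj ι (posPartSub ι x u) e) = 0 := by
  have hl := hι.isLUB_bandProj x u he
  have h0 := hι.bandProj_nonneg x u he
  have h1 := hι.bandProj_le x u he
  set p := bandProj ι (posPartSub ι x u) e
  refine le_antisymm ?_ (le_inf h0 (sub_nonneg.2 h1))
  have h2 : IsLUB ((fun z => (2 : ℝ) • z) '' {z | ∃ y, ι y ≤ x ∧ ∃ n : ℕ, z = e ⊓ n • (y - u)⁺})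
      ((2 : ℝ) • p) := by
    refine ⟨?_, fun b hb => ?_⟩
    · rintro _ ⟨z, hz, rfl⟩
      exact smul_le_smul_of_nonneg_left (hl.1 hz) zero_le_two
    · have : p ≤ (2 : ℝ)⁻¹ • b := hl.2 fun z hz => by
        have h := smul_le_smul_of_nonneg_left (hb ⟨z, hz, rfl⟩)
          (by norm_num : (0 : ℝ) ≤ 2⁻¹)
        simpa [smul_smul] using h
      have h := smul_le_smul_of_nonneg_left this (zero_le_two (α := ℝ))
      simpa [smul_smul] using h
  -- Doubling only replaces `n` by `2 * n` in the family defining `p`. Subtracting `p` from both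
  -- sides then gives `p ⊓ (e - p) ≤ 0`.
  have h3 : e ⊓ (2 : ℝ) • p ≤ p := (SupCompletion.isLUB_const_inf h2 e).2 (by
    rintro _ ⟨_, ⟨_, ⟨y, hy, n, rfl⟩, rfl⟩, rfl⟩
    refine le_trans (inf_le_inf_left e ?_) (hl.1 ⟨y, hy, 2 * n, rfl⟩)
    change (2 : ℝ) • (e ⊓ n • (y - u)⁺) ≤ _
    rw [mul_comm, mul_nsmul, two_nsmul, two_smul]
    exact add_le_add inf_le_right inf_le_right)
  rw [two_smul] at h3
  have h4 : p ⊓ (e - p) + p ≤ 0 + p := by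
    rw [inf_add, sub_add_cancel, zero_add, inf_comm]
    exact h3
  exact le_of_add_le_add_right h4

end IsSupCompletion

/-! ### Membership in the universal completion. -/

section Main

variable {X C Y : Type*}
  [ConditionallyCompleteLattice X] [AddCommGroup X] [IsOrderedAddMonoid X]
  [Module ℝ X] [PosSMulMono ℝ X]
  [ConditionallyCompleteLattice C] [AddCommMonoid C] [IsOrderedAddMonoid C]
  [Module ℝ≥0 C] [PosSMulMono ℝ≥0 C]
  [ConditionallyCompleteLattice Y] [AddCommGroup Y] [IsOrderedAddMonoid Y]
  [Module ℝ Y] [PosSMulMono ℝ Y]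
  {ι : X → C} {j : X →ₗ[ℝ] Y} {e : X} {x : C}

theorem not_memUniversalCompletion_of_le_bandProj (hι : IsSupCompletion ι)
    (hj : IsUniversalCompletion j) (he : 0 ≤ e) {p : X} (hp : 0 < p)
    (h : ∀ t : ℝ, 0 < t → p ≤ bandProj ι (posPartSub ι x (t • e)) e) :
    ¬ MemUniversalCompletion ι j x := by
  rintro ⟨f, hf⟩
  refine (hj.pos_iff.2 hp).not_ge (nonpos_of_forall_nsmul_le (g := f⁺) fun N => ?_)
  have hl := hι.isLUB_bandProj x (((N + 1 : ℕ) : ℝ) • e) he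
  refine (nsmul_le_nsmul_right (hj.le_iff_le.2 (h (N + 1 : ℕ) (by positivity))) _).trans ?_
  rw [Nat.cast_smul_eq_nsmul] at hl ⊢
  have hr : (0 : ℝ) ≤ ((N + 1 : ℕ) : ℝ)⁻¹ := by positivity
  have hne : ((N + 1 : ℕ) : ℝ) ≠ 0 := by positivity
  -- Dividing by `N + 1` isolates `p_{N+1}`, so its description as a supremum applies; the factor is
  -- restored below.
  have key : j (bandProj ι (posPartSub ι x ((N + 1) • e)) e) ≤ ((N + 1 : ℕ) : ℝ)⁻¹ • f⁺ := by
    refine (hj.isLUB_image hl).2 ?_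
    rintro _ ⟨_, ⟨y, hy, n, rfl⟩, rfl⟩
    have h1 := hj.le_iff_le.2 (LatticeGroup.nsmul_inf_nsmul_posPart_sub_le e y (N + 1) n)
    rw [hj.map_posPart] at h1
    have h2 := smul_le_smul_of_nonneg_left (h1.trans (posPart_mono ((hf y).1 hy))) hr
    rwa [map_nsmul, ← Nat.cast_smul_eq_nsmul ℝ, smul_smul, inv_mul_cancel₀ hne, one_smul] at h2
  have h3 := nsmul_le_nsmul_right key (N + 1)
  rwa [← Nat.cast_smul_eq_nsmul ℝ (N + 1) (_ • f⁺), smul_smul, mul_inv_cancel₀ hne,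
    one_smul] at h3

/-- The supremum `f` of the images works: if `j y ≤ f`, then `j y` is the supremum of the `j (y ⊓
a)` over minorants `a`. The embedding reflects this to `y = sup (y ⊓ a)` in `X`, whence `ι y ≤ x`.
-/
theorem memUniversalCompletion_of_bddAbove (hι : IsSupCompletion ι)
    (hj : IsUniversalCompletion j) (h : BddAbove (j '' {y | ι y ≤ x})) :
    MemUniversalCompletion ι j x := by
  have hne := hι.minorants_nonempty x
  have hl := isLUB_csSup (hne.image j) h
  refine ⟨sSup (j '' {y | ι y ≤ x}), fun y => ⟨fun hy => hl.1 ⟨y, hy, rfl⟩, fun hy => ?_⟩⟩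
  have hl' := SupCompletion.isLUB_const_inf hl (j y)
  rw [inf_eq_left.2 hy] at hl'
  have hm : IsLUB ((fun a => y ⊓ a) '' {y | ι y ≤ x}) y := by
    refine ⟨?_, fun b hb => hj.le_iff_le.1 (hl'.2 ?_)⟩
    · rintro _ ⟨a, -, rfl⟩
      exact inf_le_left
    · rintro _ ⟨_, ⟨a, ha, rfl⟩, rfl⟩
      change j y ⊓ j a ≤ j b
      rw [← hj.map_inf, hj.le_iff_le]
      exact hb ⟨a, ha, rfl⟩
  refine hι.le_of_isLUB (hne.image _) hm ?_
  rintro _ ⟨a, ha, rfl⟩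
  exact ((hι.le_iff_le _ _).2 inf_le_right).trans ha

/-- If `j y ≤ g` failed, order density and the weak unit would give a positive element of `X` below
both `e` and the excess. It meets some layer `r_n`, where `y ≤ (n+1)e` leaves no excess. -/
theorem bddAbove_image_minorants (hι : IsSupCompletion ι) (hj : IsUniversalCompletion j)
    (he : IsWeakOrderUnit e)
    (h : ∀ z : X, 0 < z →
      ∃ t : ℝ, 0 < t ∧ ¬ z ≤ bandProj ι (posPartSub ι x (t • e)) e) :
    BddAbove (j '' {y | ι y ≤ x}) := by
  have he0 : 0 ≤ e := he.1.le
  -- Starting at `e`, not at `P_{x⁺} e`, puts the part where `x ≤ e` into layer `0`, so no part of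
  -- `e` is lost.
  let p : ℕ → X := fun n => Nat.casesOn n e fun n => bandProj ι (posPartSub ι x ((n + 1) • e)) e
  have hp0 (n) : 0 ≤ p n := by
    cases n
    exacts [he0, hι.bandProj_nonneg x _ he0]
  have hpe (n) : p n ≤ e := by
    cases n
    exacts [le_rfl, hι.bandProj_le x _ he0]
  have hpc (n) : p n ⊓ (e - p n) = 0 := by
    cases n with
    | zero => simpa [p] using he0
    | succ n => exact hι.bandProj_inf_sub x _ he0
  have hanti : Antitone p := antitone_nat_of_succ_le fun n => by
    cases n
    · exact hpe 1
    · exact hι.bandProj_antitone x he0 (nsmul_le_nsmul_left he0 (Nat.le_succ _))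
  let r : ℕ → X := fun n => p n - p (n + 1)
  have hr0 (n) : 0 ≤ r n := sub_nonneg.2 (hanti n.le_succ)
  have hrp (n) : r n ≤ p n := sub_le_self _ (hp0 (n + 1))
  have hrq (n) : r n ≤ e - p (n + 1) := sub_le_sub_right (hpe n) _
  have hre (n) : r n ≤ e := (hrp n).trans (hpe n)
  have hr_p (n) : r n ⊓ p (n + 1) = 0 := by
    rw [inf_comm]
    exact LatticeGroup.inf_eq_zero_of_le (hp0 (n + 1)) (hr0 n) le_rfl (hrq n) (hpc (n + 1))
  have hr_e (n) : r n ⊓ (e - r n) = 0 := by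
    have : e - r n = (e - p n) + p (n + 1) := by simp only [r]; abel
    rw [this]
    exact LatticeGroup.inf_add_eq_zero (sub_nonneg.2 (hpe n)) (hp0 (n + 1)) (hr0 n)
      (LatticeGroup.inf_eq_zero_of_le (hr0 n) (sub_nonneg.2 (hpe n)) (hrp n) le_rfl (hpc n))
      (hr_p n)
  have hr_lt {m n} (hmn : m < n) : r m ⊓ r n = 0 :=
    LatticeGroup.inf_eq_zero_of_le (hr0 m) (hr0 n) le_rfl ((hrp n).trans (hanti hmn)) (hr_p m)
  have hr_ne {m n} (hmn : m ≠ n) : r m ⊓ r n = 0 := by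
    rcases hmn.lt_or_gt with h | h
    exacts [hr_lt h, inf_comm (r m) _ ▸ hr_lt h]
  have hs0 (n) : 0 ≤ (n + 1) • r n := nsmul_nonneg (hr0 n) _
  obtain ⟨g, hg⟩ := hj.laterally_complete (Set.range fun n => j ((n + 1) • r n))
    (Set.range_nonempty _)
    (by rintro _ ⟨n, rfl⟩; simpa using hj.le_iff_le.2 (hs0 n))
    (by
      rintro _ ⟨m, rfl⟩ _ ⟨n, rfl⟩ hmn
      have hmn' : m ≠ n := fun h => hmn (h ▸ rfl)
      have h1 := LatticeGroup.inf_nsmul_eq_zero (hr0 n) (hr0 m) (hr_ne hmn') (n + 1)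
      rw [inf_comm] at h1
      have h2 := LatticeGroup.inf_nsmul_eq_zero (hr0 m) (hs0 n) h1 (m + 1)
      change j _ ⊓ j _ = 0
      rw [← hj.map_inf, inf_comm, h2, map_zero])
  refine ⟨g, ?_⟩
  rintro _ ⟨y, hy, rfl⟩
  by_contra hlt
  have hpos : 0 < (j y - g)⁺ := (posPart_nonneg _).lt_of_ne' fun h0 =>
    hlt (LatticeGroup.le_of_posPart_sub_nonpos h0.le)
  obtain ⟨z, hz, hzle⟩ := hj.order_dense _ hpos
  have hz := hj.pos_iff.1 hz
  have hze : 0 < z ⊓ e := (le_inf hz.le he0).lt_of_ne' fun h0 =>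
    hz.ne' (he.2 z (by rwa [abs_of_nonneg hz.le]))
  obtain ⟨n, hn⟩ : ∃ n, z ⊓ e ⊓ r n ≠ 0 := by
    by_contra! hall
    obtain ⟨t, ht, hzt⟩ := h _ hze
    obtain ⟨N, hN⟩ := exists_nat_ge t
    have hsum := LatticeGroup.inf_sum_eq_zero hze.le hr0 hall (N + 1)
    -- The layers telescope to `e - p (N + 1)`. Being disjoint from it forces `z ⊓ e ≤ p (N + 1)`,
    -- contradicting the choice of `t ≤ N`.
    rw [Finset.sum_range_sub'] at hsum
    refine hzt (le_trans (b := p (N + 1)) ?_ (hι.bandProj_antitone x he0 ?_))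
    · calc z ⊓ e = (z ⊓ e) ⊓ (p (N + 1) + (e - p (N + 1))) := by simp
        _ ≤ (z ⊓ e) ⊓ p (N + 1) + (z ⊓ e) ⊓ (e - p (N + 1)) :=
          LatticeGroup.inf_add_le (hp0 (N + 1)) (sub_nonneg.2 (hpe (N + 1))) hze.le
        _ = (z ⊓ e) ⊓ p (N + 1) := by rw [show (z ⊓ e) ⊓ (e - p (N + 1)) = 0 from hsum, add_zero]
        _ ≤ _ := inf_le_right
    · rw [← Nat.cast_smul_eq_nsmul ℝ]
      exact smul_le_smul_of_nonneg_right (hN.trans (by simp)) he0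
  set w := z ⊓ e ⊓ r n
  have hw0 : 0 ≤ w := le_inf hze.le (hr0 n)
  have hwr : w ≤ r n := inf_le_right
  have hd : 0 ≤ (y - (n + 1) • e)⁺ := posPart_nonneg _
  have hwp : w ⊓ (y - (n + 1) • e)⁺ = 0 := by
    -- Since `r n` is disjoint from `p (n + 1)`, so is `w` from this meet; `w ≤ e` then removes `e`.
    have hm : e ⊓ (y - (n + 1) • e)⁺ ≤ p (n + 1) :=
      (hι.isLUB_bandProj x _ he0).1 ⟨y, hy, 1, by rw [one_nsmul]⟩
    have h1 := LatticeGroup.inf_eq_zero_of_le hw0 (le_inf he0 hd) hwr hm (hr_p n)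
    rwa [← inf_assoc, inf_eq_left.2 (hwr.trans (hre n))] at h1
  have hwe : w ⊓ (n + 1) • (e - r n) = 0 :=
    LatticeGroup.inf_nsmul_eq_zero (sub_nonneg.2 (hre n)) hw0
      (LatticeGroup.inf_eq_zero_of_le hw0 (sub_nonneg.2 (hre n)) hwr le_rfl (hr_e n)) _
  have hw : w ≤ (y - (n + 1) • r n)⁺ := by
    rw [← hj.le_iff_le, hj.map_posPart, map_sub]
    exact (hj.le_iff_le.2 (inf_le_left.trans inf_le_left)).trans
      (hzle.trans (posPart_mono (sub_le_sub_left (hg.1 ⟨n, rfl⟩) _)))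
  have hs : 0 ≤ (n + 1) • (e - r n) := nsmul_nonneg (sub_nonneg.2 (hre n)) _
  -- Both summands are disjoint from `w`, so `w` lies below something disjoint from it and vanishes.
  have hle : (y - (n + 1) • r n)⁺ ≤ (y - (n + 1) • e)⁺ + (n + 1) • (e - r n) := by
    refine LatticeGroup.posPart_le_of_le ?_ (add_nonneg hd hs)
    have heq (s : X) : y - (n + 1) • s = (y - (n + 1) • e) + (n + 1) • (e - s) := by
      rw [smul_sub, sub_add_sub_cancel]
    rw [heq]
    exact add_le_add_left (le_posPart _) _
  exact hn (by
    rw [← LatticeGroup.inf_add_eq_zero hd hs hw0 hwp hwe, inf_eq_left.2 (hw.trans hle)])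

end Main

theorem theorem2p9 {X C Y : Type*}
    [ConditionallyCompleteLattice X] [AddCommGroup X] [IsOrderedAddMonoid X]
    [Module ℝ X] [PosSMulMono ℝ X]
    [ConditionallyCompleteLattice C] [AddCommMonoid C] [IsOrderedAddMonoid C]
    [Module ℝ≥0 C] [PosSMulMono ℝ≥0 C]
    [ConditionallyCompleteLattice Y] [AddCommGroup Y] [IsOrderedAddMonoid Y]
    [Module ℝ Y] [PosSMulMono ℝ Y]
    (ι : X → C) (hι : IsSupCompletion ι)
    (j : X →ₗ[ℝ] Y) (hj : IsUniversalCompletion j)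
    (e : X) (he : 0 < e) (x : C) :
    ((0 < ⨅ t : Set.Ioi (0 : ℝ), bandProj ι (posPartSub ι x (t.1 • e)) e) →
      ¬ MemUniversalCompletion ι j x) ∧
    (IsWeakOrderUnit e →
      (¬ MemUniversalCompletion ι j x ↔
        (0 < ⨅ t : Set.Ioi (0 : ℝ), bandProj ι (posPartSub ι x (t.1 • e)) e))) := by

  have hne : Nonempty (Set.Ioi (0 : ℝ)) := ⟨⟨1, Set.mem_Ioi.2 one_pos⟩⟩
  -- Boundedness below makes `⨅` a genuine infimum.
  have hbdd : BddBelow (Set.range fun t : Set.Ioi (0 : ℝ) =>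
      bandProj ι (posPartSub ι x (t.1 • e)) e) :=
    ⟨0, by rintro _ ⟨t, rfl⟩; exact hι.bandProj_nonneg x _ he.le⟩
  have hnot (h : 0 < ⨅ t : Set.Ioi (0 : ℝ), bandProj ι (posPartSub ι x (t.1 • e)) e) :
      ¬ MemUniversalCompletion ι j x :=
    not_memUniversalCompletion_of_le_bandProj hι hj he.le h fun t ht => ciInf_le hbdd ⟨t, ht⟩
  refine ⟨hnot, fun hu => ⟨fun hx => ?_, hnot⟩⟩
  by_contra hinf
  refine hx (memUniversalCompletion_of_bddAbove hι hj
    (bddAbove_image_minorants hι hj hu fun z hz => ?_))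
  by_contra! hall
  exact hinf (hz.trans_le (le_ciInf fun t => hall t.1 t.2))
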